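/- Setting. Let $\nu,\mu$ be mutually absolutely continuous Borel probability measures on $\mathbb R$, and let $\lambda=\log\frac{d\mu}{d\nu}$. Put $M_0(w)=\int e^{w\lambda}\,d\nu$, $M_1(w)=\int e^{w\lambda}\,d\mu$ (values in $(0,\infty]$), and $I_j(x)=\sup_{w\in\mathbb R}\{xw-\log M_j(w)\}\in[0,\infty]$ for $j\in\{0,1\}$. Assume that $0$ is an interior point of $\{w:M_0(w)<\infty\}$ and of $\{w:M_1(w)<\infty\}$, and that the Kullback–Leibler divergences $D(1\|0)=\int\lambda\,d\mu$ and $D(0\|1)=-\int\lambda\,d\nu$ are positive and finite. Let $m>2n\ge 0$ be integers. Measurements and attacks. Under hypothesis $\theta\in\{0,1\}$, the true measurements $y_i(t)$, $i\in\{1,\dots,m\}$, $t\ge1$, are i.i.d. with law $\nu$ if $\theta=0$ and $\mu$ if $\theta=1$. The fusion center receives $y'(t)=y(t)+y^a(t)\in\mathbb R^m$. For a set $\mathcal I\subset\{1,\dots,m\}$ of compromised sensors with $|\mathcal I|=n$, an attack strategy $g$ chooses the bias $y^a(t)$, vanishing outside $\mathcal I$, as a (measurable, possibly randomized, with randomness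 independent of the measurements) function of $\theta$, $\mathcal I$, $t$, the true measurements of the sensors in $\mathcal I$ at times $1,\dots,t$, and the biases at times $1,\dots,t-1$. A detector is a sequence $f=(f_k)_{k\ge1}$ of measurable functions with values in $[0,1]$, where $f_k(y'(1),\dots,y'(k))$ is the probability of deciding $\hat\theta=1$ at time $k$. Let $\epsilon(k)$ be the maximum over $\theta\in\{0,1\}$ and $|\mathcal I|=n$ of the probability of error at time $k$ (that is, $\mathbb E f_k$ if $\theta=0$ and $1-\mathbb E f_k$ if $\theta=1$), and let $\rho(f,g)=\liminf_{k\to\infty}-\frac1k\log\epsilon(k)\in[0,\infty]$, with $\log 0=-\infty$. The efficiency of $f$ is $\mathcal E(f)=\rho(f,0)$ (no attack) and its security is $\mathcal S(f)=\inf_g\rho(f,g)$, over all attack strategies $g$. Admissible pairs. Let $C=I_0(0)$, let $I_0^{-1}(z)=\max\{x:I_0(x)=z\}$ and $I_1^{-1}(z)=\min\{x:I_1(x)=z\}$, and for $0<z<(m-n)\min\{D(0\|1),D(1\|0)\}$ let $$h(z)=(m-n)\min\Big\{I_0\big(I_1^{-1}(\tfrac{z}{m-n})\big),\,I_1\big(I_0^{-1}(\tfrac{z}{m-n})\big)\Big\}.$$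 A pair $(z_e,z_s)$ of real numbers is admissible if $0\le z_s\le(m-2n)C$ and $z_e\le mC$ if $z_s=0$, $z_e\le\min\{mC,h(z_s)\}$ if $z_s>0$. The detector $f^*_{z_s}$. At time $k$, let $\bar\lambda_i(k)=\frac1k\sum_{t=1}^k\lambda(y_i'(t))$ and $\delta(j,k)=\min_{|\mathcal O|=m-n}\sum_{i\in\mathcal O}I_j(\bar\lambda_i(k))$, over subsets $\mathcal O\subset\{1,\dots,m\}$. If $\delta(0,k)<z_s$, decide $\hat\theta=0$; otherwise, if $\delta(1,k)<z_s$, decide $\hat\theta=1$; otherwise decide $\hat\theta=0$ if $\sum_{i=1}^m\bar\lambda_i(k)<0$ and $\hat\theta=1$ if not. Theorem. For every admissible pair $(z_e,z_s)$, $$\mathcal E(f^*_{z_s})\ge z_e\qquad\text{and}\qquad\mathcal S(f^*_{z_s})\ge z_s.$$ -/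

import Mathlib

open MeasureTheory Filter

namespace ByzantineDetection

noncomputable section

/-- A detection rule for `m` sensors. `toFun k Y ∈ [0, 1]` is the probability of deciding
`θ = 1` at time `k`, given the measurements `Y t i` received from sensor `i` at the first `k`
instants `t`. -/
structure Detector (m : ℕ) where
  toFun : (k : ℕ) → (Fin k → Fin m → ℝ) → ℝ
  measurable_toFun : ∀ k, Measurable (toFun k)
  mem_unit : ∀ k Y, toFun k Y ∈ Set.Icc (0 : ℝ) 1

/-- An attack strategy against at most `n` out of `m` sensors. Time is counted from `0`.
If the hypothesis is `θ` and `S` (with `n` elements) is the set of compromised sensors, then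
`bias θ S t ω Y_S Y_a` is the bias vector injected at instant `t`; it is a function of private
randomness `ω` with law `law` (independent of the measurements), of the true measurements
`Y_S` of the sensors of `S` at the instants `0, …, t`, and of the biases `Y_a` injected at
the instants `0, …, t - 1`. It vanishes outside `S` and is otherwise arbitrary. -/
structure Attack (m n : ℕ) where
  Seed : Type
  [measurableSpaceSeed : MeasurableSpace Seed]
  law : Measure Seed
  [isProbabilityMeasure_law : IsProbabilityMeasure law]
  bias : Fin 2 → (S : Finset (Fin m)) → (t : ℕ) → Seed →
    (Fin (t + 1) → S → ℝ) → (Fin t → Fin m → ℝ) → Fin m → ℝ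
  measurable_bias : ∀ (θ : Fin 2) (S : Finset (Fin m)) (t : ℕ),
    Measurable fun p : Seed × (Fin (t + 1) → S → ℝ) × (Fin t → Fin m → ℝ) =>
      bias θ S t p.1 p.2.1 p.2.2
  sparse : ∀ θ (S : Finset (Fin m)), S.card = n →
    ∀ t ω Y_S Y_a, ∀ i ∉ S, bias θ S t ω Y_S Y_a i = 0

attribute [instance] Attack.measurableSpaceSeed Attack.isProbabilityMeasure_law

/-- The absence of any attack: the bias is identically zero. -/
def noAttack (m n : ℕ) : Attack m n where
  Seed := Unit
  law := Measure.dirac ()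
  bias := fun _ _ _ _ _ _ => 0
  measurable_bias := fun _ _ _ => measurable_const
  sparse := fun _ _ _ _ _ _ _ _ _ => rfl

variable {m n : ℕ}

/-- The bias vector injected at instant `t` along a realization `ω` of the private randomness
and `y` of all true measurements (`y (t, i)` is that of sensor `i` at instant `t`). -/
def Attack.biasAt (g : Attack m n) (θ : Fin 2) (S : Finset (Fin m)) (ω : g.Seed)
    (y : ℕ × Fin m → ℝ) (t : ℕ) : Fin m → ℝ :=
  g.bias θ S t ω (fun j i => y (j, i)) (fun j => g.biasAt θ S ω y j)
termination_by t
decreasing_by exact j.isLt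

/-- The measurements received by the fusion center at the first `k` instants. -/
def Attack.received (g : Attack m n) (θ : Fin 2) (S : Finset (Fin m)) (ω : g.Seed)
    (y : ℕ × Fin m → ℝ) (k : ℕ) : Fin k → Fin m → ℝ :=
  fun t i => y (t, i) + g.biasAt θ S ω y t i

section Model

/- `P θ` is the law of a single measurement under the hypothesis `θ`. -/
variable (P : Fin 2 → Measure ℝ)

/-- The joint law of all the true measurements under `θ`: they are i.i.d. with law `P θ`. -/
def trueLaw (m : ℕ) [∀ θ, IsProbabilityMeasure (P θ)] (θ : Fin 2) : Measure (ℕ × Fin m → ℝ) :=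
  Measure.infinitePi fun _ => P θ

/-- The probability of error at time `k`. -/
def errorProb [∀ θ, IsProbabilityMeasure (P θ)] (f : Detector m) (g : Attack m n)
    (θ : Fin 2) (S : Finset (Fin m)) (k : ℕ) : ℝ :=
  if θ = 0 then
    ∫ p, f.toFun k (g.received 0 S p.1 p.2 k) ∂(g.law.prod (trueLaw P m 0))
  else
    1 - ∫ p, f.toFun k (g.received 1 S p.1 p.2 k) ∂(g.law.prod (trueLaw P m 1))

/-- The largest probability of error at time `k` over the hypotheses and the sets of `n`
compromised sensors. -/
def worstError [∀ θ, IsProbabilityMeasure (P θ)] (f : Detector m) (g : Attack m n)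
    (k : ℕ) : ENNReal :=
  ⨆ θ : Fin 2, ⨆ S ∈ Finset.powersetCard n (Finset.univ : Finset (Fin m)),
    ENNReal.ofReal (errorProb P f g θ S k)

/-- The exponential rate of decay of the worst-case probability of error; here
`log 0 = -∞`. -/
def rate [∀ θ, IsProbabilityMeasure (P θ)] (f : Detector m) (g : Attack m n) : EReal :=
  liminf (fun k : ℕ => -(ENNReal.log (worstError P f g k)) / (k : EReal)) atTop

/-- The efficiency of a detection rule. -/
def efficiency [∀ θ, IsProbabilityMeasure (P θ)] (n : ℕ) (f : Detector m) : EReal :=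
  rate P f (noAttack m n)

/-- The security of a detection rule against `n` compromised sensors. -/
def security [∀ θ, IsProbabilityMeasure (P θ)] (n : ℕ) (f : Detector m) : EReal :=
  ⨅ g : Attack m n, rate P f g

/-- The log-likelihood ratio of one measurement. -/
def logLR : ℝ → ℝ := llr (P 1) (P 0)

/-- The moment generating function of the log-likelihood ratio under `θ`, with values in
`[0, ∞]`. -/
def momentGen (θ : Fin 2) (w : ℝ) : ENNReal :=
  ∫⁻ y, ENNReal.ofReal (Real.exp (w * logLR P y)) ∂(P θ)

/-- The rate function `I_θ`: the Fenchel–Legendre transform of the logarithm of the moment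
generating function, with values in `[0, ∞]`. -/
def rateFun (θ : Fin 2) (x : ℝ) : EReal :=
  ⨆ w : ℝ, ((x * w : ℝ) : EReal) - ENNReal.log (momentGen P θ w)

/-- The constant `C = I_0(0)`. -/
def chernoff : EReal := rateFun P 0 0

/-- `I_0⁻¹(z)`, the largest `x` with `I_0(x) = z`. -/
def invRate0 (z : ℝ) : ℝ := sSup {x : ℝ | rateFun P 0 x = (z : EReal)}

/-- `I_1⁻¹(z)`, the smallest `x` with `I_1(x) = z`. -/
def invRate1 (z : ℝ) : ℝ := sInf {x : ℝ | rateFun P 1 x = (z : EReal)}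

/-- The trade-off function `h`, meant for `0 < z < (m - n) min(D(0‖1), D(1‖0))`. -/
def tradeoff (m n : ℕ) (z : ℝ) : EReal :=
  (((m : ℝ) - n : ℝ) : EReal) *
    min (rateFun P 0 (invRate1 P (z / ((m : ℝ) - n))))
      (rateFun P 1 (invRate0 P (z / ((m : ℝ) - n))))

/-- The upper limit `h_e` of the efficiency at a positive security. -/
def maxEfficiency (m n : ℕ) (z : ℝ) : EReal :=
  min ((m : EReal) * chernoff P) (tradeoff P m n z)

/-- Admissible pairs of efficiency and security. -/
def AdmissiblePair (m n : ℕ) (ze zs : ℝ) : Prop :=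
  0 ≤ zs ∧ (zs : EReal) ≤ (((m : ℝ) - 2 * n : ℝ) : EReal) * chernoff P ∧
    (zs = 0 → (ze : EReal) ≤ (m : EReal) * chernoff P) ∧
    (0 < zs → (ze : EReal) ≤ maxEfficiency P m n zs)

/-- The empirical mean of the log-likelihood ratios of sensor `i` up to time `k`. -/
def meanLLR (k : ℕ) (Y : Fin k → Fin m → ℝ) (i : Fin m) : ℝ :=
  (∑ t : Fin k, logLR P (Y t i)) / k

/-- The sum of the `m - n` smallest values of `I_θ` at the empirical means. -/
def trimmedSum (n : ℕ) (θ : Fin 2) (k : ℕ) (Y : Fin k → Fin m → ℝ) : EReal :=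
  ⨅ O ∈ Finset.powersetCard (m - n) (Finset.univ : Finset (Fin m)),
    ∑ i ∈ O, rateFun P θ (meanLLR P k Y i)

/-- The decision of the algorithm with parameter `z` at time `k`. -/
def decision (n : ℕ) (z : ℝ) (k : ℕ) (Y : Fin k → Fin m → ℝ) : ℝ :=
  if trimmedSum P n 0 k Y < (z : EReal) then 0
  else if trimmedSum P n 1 k Y < (z : EReal) then 1
  else if ∑ i, meanLLR P k Y i < 0 then 0
  else 1

theorem measurable_rateFun (θ : Fin 2) : Measurable (rateFun P θ) := by
  refine LowerSemicontinuous.measurable (lowerSemicontinuous_iSup fun w => ?_)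
  suffices h : Continuous fun x : ℝ => ((x * w : ℝ) : EReal) - ENNReal.log (momentGen P θ w) from
    h.lowerSemicontinuous
  induction ENNReal.log (momentGen P θ w) with
  | bot => simp only [sub_eq_add_neg, EReal.neg_bot, EReal.coe_add_top, continuous_const]
  | top => simp only [EReal.sub_top, continuous_const]
  | coe c =>
    have : (fun x : ℝ => ((x * w : ℝ) : EReal) - (c : EReal)) =
        fun x : ℝ => ((x * w - c : ℝ) : EReal) := by
      funext x; norm_cast
    rw [this]
    exact continuous_coe_real_ereal.comp (by fun_prop)

theorem measurable_meanLLR (k : ℕ) (i : Fin m) :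
    Measurable fun Y : Fin k → Fin m → ℝ => meanLLR P k Y i := by
  have h : Measurable (logLR P) := measurable_llr _ _
  unfold meanLLR
  fun_prop

theorem measurable_trimmedSum (n : ℕ) (θ : Fin 2) (k : ℕ) :
    Measurable fun Y : Fin k → Fin m → ℝ => trimmedSum P n θ k Y := by
  unfold trimmedSum
  refine Measurable.iInf fun O => Measurable.iInf fun _ => ?_
  exact Finset.measurable_fun_sum _ fun i _ =>
    (measurable_rateFun P θ).comp (measurable_meanLLR P k i)

theorem measurable_decision (n : ℕ) (z : ℝ) (k : ℕ) :
    Measurable fun Y : Fin k → Fin m → ℝ => decision P n z k Y := by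
  unfold decision
  refine Measurable.ite (measurableSet_lt (measurable_trimmedSum P n 0 k) measurable_const)
    measurable_const (Measurable.ite
      (measurableSet_lt (measurable_trimmedSum P n 1 k) measurable_const) measurable_const
      (Measurable.ite (measurableSet_lt
        (Finset.measurable_fun_sum _ fun i _ => measurable_meanLLR P k i) measurable_const)
        measurable_const measurable_const))

/-- The detector `f*_z` for `m` sensors of which `n` may be compromised. -/
def fStar (m n : ℕ) (z : ℝ) : Detector m where
  toFun := decision P n z
  measurable_toFun := measurable_decision P n z
  mem_unit := fun k Y => by
    unfold decision
    split_ifs <;> simp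

end Model

end

end ByzantineDetection

/-!
For `x` on the far side of the mean of the log-likelihood ratio, Chernoff's inequality bounds the
probability that an empirical mean over `k` measurements lies beyond `x` by `exp (-k I_θ(x))`.
Inner regularity turns these half-line bounds into
`P (I_θ(mean) > u) ≤ 2 exp (-k u)` (`meas_lt_legendre_le`), whence the moments
`E exp (s k I_θ(mean))` with `s < 1` are bounded uniformly in `k`
(`lintegral_exp_legendre_le`). By independence of the sensors and Markov's inequality, the
probability that `∑ i ∈ Q, I_θ(mean_i) ≥ c` decays at rate `c`
(`trueLaw_le_sum_rateFun_le`).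

It remains to see that every error of the detection rule forces such a sum to be at least `c`.
This is convexity: `I_0` vanishes at a negative point and increases on its right, `I_1` vanishes at
a positive point and decreases on its left, and `I_0(0) = I_1(0) = C` since
`M_1(w) = M_0(w + 1)`.

* Security (`c = zs`, `Q` the sound sensors). A wrong decision that passes the test of the true
  hypothesis gives the bound at once. The only other error is to decide `0` under `1` because some
  `m - n` sensors look like `0`; at least `m - 2 n` of these are sound, and as their sum of `I_0` is
  below `zs ≤ (m - 2 n) C`, their mean is negative, so that their sum of `I_1` is at least
  `(m - 2 n) C`.
* Efficiency (`c = ze`, `Q` all sensors). An error by the sign of the sum costs `m C`. An error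
  because `m - n` sensors pass the test of the wrong hypothesis puts their mean beyond the level
  point in the definition of the trade-off function, which costs at least that function.

The rate functions are treated as Legendre transforms with values in `EReal`, and the two hypotheses
are exchanged by the reflection `x ↦ -x`.
-/

namespace ByzantineDetection

/-! ### Legendre transforms with values in the extended reals -/

/-- The Legendre transform of `L : ℝ → EReal`. -/
noncomputable def legendre (L : ℝ → EReal) (x : ℝ) : EReal :=
  ⨆ w : ℝ, ((x * w : ℝ) : EReal) - L w

theorem legendre_comp_neg (L : ℝ → EReal) (x : ℝ) :
    legendre (fun w => L (-w)) (-x) = legendre L x := by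
  unfold legendre
  rw [← (Equiv.neg ℝ).iSup_comp (g := fun w => ((-x * w : ℝ) : EReal) - L (-w))]
  simp

theorem coe_sum_ereal {ι : Type*} (O : Finset ι) (f : ι → ℝ) :
    ((∑ i ∈ O, f i : ℝ) : EReal) = ∑ i ∈ O, (f i : EReal) :=
  map_sum (⟨⟨Real.toEReal, EReal.coe_zero⟩, EReal.coe_add⟩ : ℝ →+ EReal) f O

theorem lowerSemicontinuous_legendre (L : ℝ → EReal) : LowerSemicontinuous (legendre L) := by
  refine lowerSemicontinuous_iSup fun w => ?_
  suffices h : Continuous fun x : ℝ => ((x * w : ℝ) : EReal) - L w from h.lowerSemicontinuous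
  induction L w with
  | bot => simp only [sub_eq_add_neg, EReal.neg_bot, EReal.coe_add_top, continuous_const]
  | top => simp only [EReal.sub_top, continuous_const]
  | coe c =>
    simp only [← EReal.coe_sub]
    exact continuous_coe_real_ereal.comp (by fun_prop)

section

variable {L : ℝ → EReal} {d : ℝ}

/-- An upper bound for the Legendre transform of a function above a line needs to be checked only
where that function is real. -/
theorem legendre_le (hd : ∀ w, ((d * w : ℝ) : EReal) ≤ L w) {x : ℝ} {b : EReal}
    (h : ∀ w l : ℝ, L w = l → ((x * w - l : ℝ) : EReal) ≤ b) : legendre L x ≤ b := by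
  refine iSup_le fun w => ?_
  have hdw := hd w
  have hw := h w
  induction hl : L w with
  | bot => exact absurd (hl ▸ hdw) (by simp only [le_bot_iff, EReal.coe_ne_bot, not_false_eq_true])
  | top => simp
  | coe l => exact_mod_cast hw l hl

theorem le_legendre (x : ℝ) {w l : ℝ} (hl : L w = l) :
    ((x * w - l : ℝ) : EReal) ≤ legendre L x := by
  refine le_trans ?_ (le_iSup _ w)
  rw [hl, EReal.coe_sub]

theorem legendre_nonneg (h0 : L 0 = 0) (x : ℝ) : 0 ≤ legendre L x := by
  have h := le_legendre (w := 0) (l := 0) x h0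
  rwa [mul_zero, sub_zero, EReal.coe_zero] at h

theorem legendre_slope (hd : ∀ w, ((d * w : ℝ) : EReal) ≤ L w) : legendre L d ≤ 0 := by
  refine legendre_le hd fun w l hl => ?_
  have := hd w
  rw [hl, EReal.coe_le_coe_iff] at this
  exact_mod_cast sub_nonpos.2 this

theorem legendre_mono (h0 : L 0 = 0) (hd : ∀ w, ((d * w : ℝ) : EReal) ≤ L w) {x y : ℝ}
    (hx : d ≤ x) (hxy : x ≤ y) : legendre L x ≤ legendre L y := by
  refine legendre_le hd fun w l hl => ?_
  rcases le_total 0 w with hw | hw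
  · exact le_trans (by exact_mod_cast sub_le_sub_right (mul_le_mul_of_nonneg_right hxy hw) l)
      (le_legendre y hl)
  · refine le_trans ?_ (legendre_nonneg h0 y)
    have := hd w
    rw [hl, EReal.coe_le_coe_iff] at this
    have h2 := mul_le_mul_of_nonpos_right hx hw
    exact_mod_cast (by linarith : x * w - l ≤ 0)

theorem card_mul_legendre_mean_le (hd : ∀ w, ((d * w : ℝ) : EReal) ≤ L w) {ι : Type*}
    {O : Finset ι} (hO : O.Nonempty) (x : ι → ℝ) :
    (O.card : EReal) * legendre L ((∑ i ∈ O, x i) / O.card) ≤ ∑ i ∈ O, legendre L (x i) := by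
  have hq : (0 : ℝ) < O.card := by exact_mod_cast hO.card_pos
  rw [mul_comm, ← EReal.le_div_iff_mul_le (by exact_mod_cast hq) (EReal.natCast_ne_top _)]
  refine legendre_le hd fun w l hl => ?_
  rw [EReal.le_div_iff_mul_le (by exact_mod_cast hq) (EReal.natCast_ne_top _)]
  have : ((∑ i ∈ O, x i) / O.card * w - l) * O.card = ∑ i ∈ O, (x i * w - l) := by
    rw [Finset.sum_sub_distrib, ← Finset.sum_mul, Finset.sum_const, nsmul_eq_mul]
    field_simp
  calc (((∑ i ∈ O, x i) / O.card * w - l : ℝ) : EReal) * (O.card : EReal)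
      = ((∑ i ∈ O, (x i * w - l) : ℝ) : EReal) := by rw [← this]; push_cast; rfl
    _ ≤ _ := by
        rw [coe_sum_ereal]
        exact Finset.sum_le_sum fun i _ => le_legendre (x i) hl

theorem legendre_convex (hd : ∀ w, ((d * w : ℝ) : EReal) ≤ L w) {x y a b t : ℝ}
    (hx : legendre L x ≤ a) (hy : legendre L y ≤ b) (ht : 0 ≤ t) (ht1 : t ≤ 1) :
    legendre L ((1 - t) * x + t * y) ≤ (((1 - t) * a + t * b : ℝ) : EReal) := by
  refine legendre_le hd fun w l hl => ?_
  have h1 := (le_legendre x hl).trans hx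
  have h2 := (le_legendre y hl).trans hy
  rw [EReal.coe_le_coe_iff] at *
  have := mul_le_mul_of_nonneg_left h1 (sub_nonneg.2 ht1)
  have := mul_le_mul_of_nonneg_left h2 ht
  nlinarith

theorem card_mul_legendre_zero_le (h0 : L 0 = 0) (hd : ∀ w, ((d * w : ℝ) : EReal) ≤ L w)
    (hneg : d ≤ 0) {ι : Type*} {O : Finset ι} {x : ι → ℝ} (hx : 0 ≤ ∑ i ∈ O, x i) :
    (O.card : EReal) * legendre L 0 ≤ ∑ i ∈ O, legendre L (x i) := by
  rcases O.eq_empty_or_nonempty with rfl | hO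
  · simp
  refine le_trans ?_ (card_mul_legendre_mean_le hd hO x)
  exact mul_le_mul_of_nonneg_left (legendre_mono h0 hd hneg (by positivity))
    (by exact_mod_cast O.card.cast_nonneg (α := ℝ))

/-- The level `z` is attained between `y` and `0`, for the restriction of a Legendre transform to a
segment is continuous. -/
theorem exists_legendre_eq (h0 : L 0 = 0) (hd : ∀ w, ((d * w : ℝ) : EReal) ≤ L w)
    {y z : ℝ} (hy : y ≤ 0) (hyz : legendre L y < z) (hz : (z : EReal) ≤ legendre L 0)
    (hfin : legendre L 0 < ⊤) : ∃ x, y ≤ x ∧ x ≤ 0 ∧ legendre L x = z := by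
  have hcl : IsClosed {x | legendre L x ≤ z} :=
    (lowerSemicontinuous_legendre L).isClosed_preimage (z : EReal)
  obtain ⟨x, ⟨⟨hyx, hx0⟩, hxz⟩, hmax⟩ := (isCompact_Icc (a := y) (b := 0)).inter_right hcl
    |>.exists_isGreatest ⟨y, ⟨le_rfl, hy⟩, hyz.le⟩
  refine ⟨x, hyx, hx0, le_antisymm hxz (not_lt.1 fun hlt => ?_)⟩
  have hxneg : x < 0 := lt_of_le_of_ne hx0 fun h => by
    rw [h] at hlt; exact absurd hz (not_le.2 hlt)
  -- Real values `a < z ≤ c` at `x` and `0`; by convexity the level `z` is not exceeded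
  -- at a point beyond `x`.
  obtain ⟨c, hc⟩ : ∃ c : ℝ, legendre L 0 = c :=
    ⟨_, (EReal.coe_toReal hfin.ne (ne_bot_of_le_ne_bot (by simp) (legendre_nonneg h0 0))).symm⟩
  obtain ⟨a, ha⟩ : ∃ a : ℝ, legendre L x = a :=
    ⟨_, (EReal.coe_toReal (hlt.trans (EReal.coe_lt_top z)).ne
      (ne_bot_of_le_ne_bot (by simp) (legendre_nonneg h0 x))).symm⟩
  rw [ha, EReal.coe_lt_coe_iff] at hlt
  rw [hc, EReal.coe_le_coe_iff] at hz
  have hca : 0 < c - a := by linarith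
  have ht : 0 < (z - a) / (c - a) := div_pos (by linarith) hca
  have ht1 : (z - a) / (c - a) ≤ 1 := (div_le_one hca).2 (by linarith)
  have hval : (1 - (z - a) / (c - a)) * a + (z - a) / (c - a) * c = z := by field_simp; ring
  have hcv := legendre_convex hd ha.le hc.le ht.le ht1
  rw [hval] at hcv
  have := hmax ⟨⟨?_, ?_⟩, hcv⟩
  all_goals nlinarith [mul_pos ht (neg_pos.2 hxneg)]

theorem nonpos_of_legendre_eq (hd : ∀ w, ((d * w : ℝ) : EReal) ≤ L w) (hneg : d < 0)
    {x z : ℝ} (hz0 : 0 < z) (hz : (z : EReal) ≤ legendre L 0) (hx : legendre L x = z) :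
    x ≤ 0 := by
  by_contra! hpos
  have hxd : 0 < x - d := by linarith
  have ht1 : -d / (x - d) < 1 := (div_lt_one hxd).2 (by linarith)
  have hcv := legendre_convex hd (legendre_slope hd) hx.le
    (div_pos (neg_pos.2 hneg) hxd).le ht1.le
  have hval : (1 - -d / (x - d)) * d + -d / (x - d) * x = 0 := by field_simp; ring
  rw [hval] at hcv
  have := hz.trans hcv
  rw [EReal.coe_le_coe_iff] at this
  nlinarith

/-- A point where the transform is below the level `z` lies left of the last point of that level,
which is not positive. -/
theorem le_sSup_level (h0 : L 0 = 0) (hd : ∀ w, ((d * w : ℝ) : EReal) ≤ L w) (hneg : d < 0)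
    {y z : ℝ} (hz0 : 0 < z) (hyz : legendre L y < z) (hz : (z : EReal) ≤ legendre L 0)
    (hfin : legendre L 0 < ⊤) :
    y ≤ sSup {x | legendre L x = z} ∧ sSup {x | legendre L x = z} ≤ 0 := by
  have hup : ∀ x ∈ {x | legendre L x = z}, x ≤ 0 := fun x hx =>
    nonpos_of_legendre_eq hd hneg hz0 hz hx
  have hy : y ≤ 0 := by
    by_contra! hy
    exact absurd (hz.trans (legendre_mono h0 hd hneg.le hy.le)) (not_le.2 hyz)
  obtain ⟨x, hyx, -, hx⟩ := exists_legendre_eq h0 hd hy hyz hz hfin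
  exact ⟨hyx.trans (le_csSup ⟨0, hup⟩ hx), Real.sSup_nonpos hup⟩

end

/-! ### Chernoff bounds for the rate function at random points -/

section

open ProbabilityTheory

variable {Ω : Type*} [MeasurableSpace Ω] {μ : Measure Ω} {L : ℝ → EReal} {d κ : ℝ}

theorem meas_ge_le_of_lt_legendre [IsProbabilityMeasure μ] {X : Ω → ℝ} (hX : Measurable X)
    (hκ : 0 ≤ κ) (hd : ∀ w, ((d * w : ℝ) : EReal) ≤ L w)
    (hmgf : ∀ w l : ℝ, L w = l →
      ∫⁻ ω, ENNReal.ofReal (Real.exp (w * (κ * X ω))) ∂μ ≤ ENNReal.ofReal (Real.exp (κ * l)))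
    {x u : ℝ} (hx : d ≤ x) (hu : u < legendre L x) :
    μ {ω | x ≤ X ω} ≤ ENNReal.ofReal (Real.exp (-(κ * u))) := by
  obtain ⟨w, l, hl, hlt⟩ : ∃ w l : ℝ, L w = l ∧ u < x * w - l := by
    by_contra! hcon
    exact absurd (legendre_le hd fun w l hl => EReal.coe_le_coe_iff.2 (hcon w l hl))
      (not_le.2 hu)
  rcases le_total 0 w with hw | hw
  · have hmeas : Measurable fun ω => ENNReal.ofReal (Real.exp (w * (κ * X ω))) := by fun_prop
    have hmarkov := mul_meas_ge_le_lintegral hmeas (μ := μ)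
      (ENNReal.ofReal (Real.exp (w * (κ * x))))
    have hsub : μ {ω | x ≤ X ω} ≤ μ {ω | ENNReal.ofReal (Real.exp (w * (κ * x))) ≤
        ENNReal.ofReal (Real.exp (w * (κ * X ω)))} :=
      measure_mono fun ω (hω : x ≤ X ω) => ENNReal.ofReal_le_ofReal (Real.exp_le_exp.2 (by gcongr))
    have h := (mul_le_mul_right hsub _).trans (hmarkov.trans (hmgf w l hl))
    calc μ {ω | x ≤ X ω}
        = ENNReal.ofReal (Real.exp (-(w * (κ * x)))) *
          (ENNReal.ofReal (Real.exp (w * (κ * x))) * μ {ω | x ≤ X ω}) := by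
          rw [← mul_assoc, ← ENNReal.ofReal_mul (Real.exp_pos _).le, ← Real.exp_add]
          simp
      _ ≤ ENNReal.ofReal (Real.exp (-(w * (κ * x)))) * ENNReal.ofReal (Real.exp (κ * l)) := by
          gcongr
      _ ≤ _ := by
          rw [← ENNReal.ofReal_mul (Real.exp_pos _).le, ← Real.exp_add]
          refine ENNReal.ofReal_le_ofReal (Real.exp_le_exp.2 ?_)
          nlinarith [mul_le_mul_of_nonneg_left hlt.le hκ]
  · -- For `w ≤ 0` the line `x * w - l` is not above `0`, so that the bound is trivial.
    have h1 := hd w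
    rw [hl, EReal.coe_le_coe_iff] at h1
    have h2 := mul_le_mul_of_nonpos_right hx hw
    refine prob_le_one.trans (ENNReal.one_le_ofReal.2 (Real.one_le_exp ?_))
    nlinarith

/-- The half-line bound at every point passes to the up-set `{x ≥ d | u < legendre L x}`, by inner
regularity: a compact subset lies in the half-line that starts at its least element. -/
theorem meas_lt_legendre_right_le [IsProbabilityMeasure μ] {X : Ω → ℝ} (hX : Measurable X)
    (hκ : 0 ≤ κ) (hd : ∀ w, ((d * w : ℝ) : EReal) ≤ L w)
    (hmgf : ∀ w l : ℝ, L w = l →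
      ∫⁻ ω, ENNReal.ofReal (Real.exp (w * (κ * X ω))) ∂μ ≤ ENNReal.ofReal (Real.exp (κ * l)))
    (u : ℝ) :
    μ {ω | d ≤ X ω ∧ u < legendre L (X ω)} ≤ ENNReal.ofReal (Real.exp (-(κ * u))) := by
  have hA : MeasurableSet {x : ℝ | d ≤ x ∧ u < legendre L x} :=
    measurableSet_Ici.inter
      (measurableSet_lt measurable_const (lowerSemicontinuous_legendre L).measurable)
  have : IsProbabilityMeasure (μ.map X) := Measure.isProbabilityMeasure_map hX.aemeasurable
  change μ (X ⁻¹' {x : ℝ | d ≤ x ∧ u < legendre L x}) ≤ _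
  rw [← Measure.map_apply hX hA]
  by_contra! hlt
  obtain ⟨K, hKA, hK, hlt⟩ := hA.exists_lt_isCompact hlt
  rcases K.eq_empty_or_nonempty with rfl | hne
  · simp at hlt
  obtain ⟨x, hxK, hmin⟩ := hK.exists_isLeast hne
  refine absurd hlt (not_lt.2 ?_)
  calc (μ.map X) K ≤ (μ.map X) (Set.Ici x) := measure_mono fun y hy => hmin hy
    _ = μ {ω | x ≤ X ω} := Measure.map_apply hX measurableSet_Ici
    _ ≤ _ := meas_ge_le_of_lt_legendre hX hκ hd hmgf (hKA hxK).1 (hKA hxK).2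

theorem meas_lt_legendre_le [IsProbabilityMeasure μ] {X : Ω → ℝ} (hX : Measurable X)
    (hκ : 0 ≤ κ) (hd : ∀ w, ((d * w : ℝ) : EReal) ≤ L w)
    (hmgf : ∀ w l : ℝ, L w = l →
      ∫⁻ ω, ENNReal.ofReal (Real.exp (w * (κ * X ω))) ∂μ ≤ ENNReal.ofReal (Real.exp (κ * l)))
    (u : ℝ) :
    μ {ω | u < legendre L (X ω)} ≤ 2 * ENNReal.ofReal (Real.exp (-(κ * u))) := by
  have hright := meas_lt_legendre_right_le hX hκ hd hmgf u
  have hleft := meas_lt_legendre_right_le (L := fun w => L (-w)) (d := -d) hX.neg hκ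
    (fun w => by simpa using hd (-w))
    (fun w l hl => by simpa using hmgf (-w) l hl) u
  simp only [Pi.neg_apply, legendre_comp_neg] at hleft
  rw [two_mul]
  refine le_trans (measure_mono fun ω (hω : u < legendre L (X ω)) => ?_)
    ((measure_union_le _ _).trans (add_le_add hright hleft))
  rcases le_total d (X ω) with h | h
  · exact Or.inl ⟨h, hω⟩
  · exact Or.inr ⟨neg_le_neg h, hω⟩

/-- A bound, not depending on the number of measurements, for the exponential moment of order
`s < 1` of the rate function at the empirical mean. -/
noncomputable def expMomentBound (s : ℝ) : ENNReal :=
  1 + 2 * ENNReal.ofReal (Real.exp s) * (1 - ENNReal.ofReal (Real.exp (s - 1)))⁻¹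

theorem expMomentBound_lt_top {s : ℝ} (hs : s < 1) : expMomentBound s < ⊤ := by
  have h : ENNReal.ofReal (Real.exp (s - 1)) < 1 := by
    rw [ENNReal.ofReal_lt_one, Real.exp_lt_one_iff]; linarith
  have h2 : (1 - ENNReal.ofReal (Real.exp (s - 1)))⁻¹ ≠ ⊤ :=
    ENNReal.inv_ne_top.2 (tsub_pos_iff_lt.2 h).ne'
  unfold expMomentBound
  finiteness

theorem one_le_expMomentBound (s : ℝ) : 1 ≤ expMomentBound s := le_self_add

/-- Slicing of an exponential along the levels `j / κ` of the exponent. -/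
theorem exp_mul_le_one_add_tsum (hκ : 0 < κ) {s : ℝ} (hs : 0 < s) (I : EReal) :
    EReal.exp (I * (κ * s : ℝ)) ≤ 1 + ∑' j : ℕ, ENNReal.ofReal (Real.exp (s * (j + 1))) *
      Set.indicator {I : EReal | ((j / κ : ℝ) : EReal) < I} 1 I := by
  induction I with
  | bot => rw [EReal.bot_mul_coe_of_pos (by positivity)]; simp
  | top =>
    suffices h : ∑' j : ℕ, ENNReal.ofReal (Real.exp (s * (j + 1))) *
        Set.indicator {I : EReal | ((j / κ : ℝ) : EReal) < I} 1 ⊤ = ⊤ by rw [h]; simp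
    rw [← top_le_iff, ← ENNReal.tsum_const_eq_top_of_ne_zero (α := ℕ) one_ne_zero]
    refine ENNReal.tsum_le_tsum fun j => ?_
    rw [Set.indicator_of_mem (by exact EReal.coe_lt_top _), Pi.one_apply, mul_one]
    exact ENNReal.one_le_ofReal.2 (Real.one_le_exp (by positivity))
  | coe r =>
    rw [← EReal.coe_mul, EReal.exp_coe]
    rcases le_or_gt r 0 with hr | hr
    · refine le_add_right (ENNReal.ofReal_le_one.2 (Real.exp_le_one_iff.2 ?_))
      exact mul_nonpos_of_nonpos_of_nonneg hr (by positivity)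
    · have hc : 0 < ⌈κ * r⌉₊ := Nat.ceil_pos.2 (by positivity)
      obtain ⟨j, hj⟩ := Nat.exists_eq_add_one_of_ne_zero hc.ne'
      have hj1 : κ * r ≤ j + 1 := by
        have := Nat.le_ceil (κ * r); rw [hj] at this; exact_mod_cast this
      have hj2 : (j : ℝ) < κ * r := Nat.lt_ceil.1 (by omega)
      refine le_add_left (le_trans ?_ (ENNReal.le_tsum j))
      rw [Set.indicator_of_mem, Pi.one_apply, mul_one]
      · refine ENNReal.ofReal_le_ofReal (Real.exp_le_exp.2 ?_)
        nlinarith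
      · exact EReal.coe_lt_coe_iff.2 ((div_lt_iff₀ hκ).2 (by linarith))

theorem lintegral_exp_legendre_le [IsProbabilityMeasure μ] {X : Ω → ℝ} (hX : Measurable X)
    (hκ : 0 < κ) (hd : ∀ w, ((d * w : ℝ) : EReal) ≤ L w)
    (hmgf : ∀ w l : ℝ, L w = l →
      ∫⁻ ω, ENNReal.ofReal (Real.exp (w * (κ * X ω))) ∂μ ≤ ENNReal.ofReal (Real.exp (κ * l)))
    {s : ℝ} (hs : 0 < s) :
    ∫⁻ ω, EReal.exp (legendre L (X ω) * (κ * s : ℝ)) ∂μ ≤ expMomentBound s := by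
  have hI : Measurable fun ω => legendre L (X ω) :=
    (lowerSemicontinuous_legendre L).measurable.comp hX
  have hset (j : ℕ) : MeasurableSet {ω | ((j / κ : ℝ) : EReal) < legendre L (X ω)} :=
    measurableSet_lt measurable_const hI
  calc ∫⁻ ω, EReal.exp (legendre L (X ω) * (κ * s : ℝ)) ∂μ
      ≤ ∫⁻ ω, (1 + ∑' j : ℕ, ENNReal.ofReal (Real.exp (s * (j + 1))) *
          Set.indicator {ω | ((j / κ : ℝ) : EReal) < legendre L (X ω)} 1 ω) ∂μ :=
        lintegral_mono fun ω => exp_mul_le_one_add_tsum hκ hs _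
    _ = 1 + ∑' j : ℕ, ENNReal.ofReal (Real.exp (s * (j + 1))) *
          μ {ω | ((j / κ : ℝ) : EReal) < legendre L (X ω)} := by
        rw [lintegral_add_left measurable_const, lintegral_const, measure_univ, mul_one,
          lintegral_tsum fun j => ((measurable_one.indicator (hset j)).const_mul _).aemeasurable]
        congr 2 with j
        rw [lintegral_const_mul _ (measurable_one.indicator (hset j)),
          lintegral_indicator_one (hset j)]
    _ ≤ 1 + ∑' j : ℕ, 2 * ENNReal.ofReal (Real.exp s) * ENNReal.ofReal (Real.exp (s - 1)) ^ j := by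
        refine add_le_add le_rfl (ENNReal.tsum_le_tsum fun j => ?_)
        refine (mul_le_mul_right (meas_lt_legendre_le hX hκ.le hd hmgf _) _).trans_eq ?_
        rw [mul_left_comm, ← ENNReal.ofReal_mul (Real.exp_pos _).le, ← Real.exp_add,
          ← ENNReal.ofReal_pow (Real.exp_pos _).le, ← Real.exp_nat_mul, mul_assoc,
          ← ENNReal.ofReal_mul (Real.exp_pos _).le, ← Real.exp_add]
        congr 3
        field_simp
        ring
    _ = expMomentBound s := by
        rw [ENNReal.tsum_mul_left, ENNReal.tsum_geometric, expMomentBound]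

theorem exp_sum_mul {ι : Type*} (Q : Finset ι) (I : ι → EReal) {c : ℝ} (hc : 0 ≤ c) :
    EReal.exp ((∑ i ∈ Q, I i) * c) = ∏ i ∈ Q, EReal.exp (I i * c) := by
  classical
  simp only [EReal.exp_mul]
  induction Q using Finset.induction_on with
  | empty => simp
  | insert i Q hi ih =>
    rw [Finset.sum_insert hi, Finset.prod_insert hi, EReal.exp_add, ← ih,
      ENNReal.mul_rpow_of_nonneg _ _ hc]

theorem meas_le_sum_legendre_le {ι : Type*} {X : ι → Ω → ℝ} (hX : ∀ i, Measurable (X i))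
    (hind : iIndepFun X μ) (hκ : 0 < κ) (hd : ∀ w, ((d * w : ℝ) : EReal) ≤ L w)
    (hmgf : ∀ i, ∀ w l : ℝ, L w = l →
      ∫⁻ ω, ENNReal.ofReal (Real.exp (w * (κ * X i ω))) ∂μ ≤ ENNReal.ofReal (Real.exp (κ * l)))
    {s : ℝ} (hs : 0 < s) (Q : Finset ι) (z : ℝ) :
    μ {ω | (z : EReal) ≤ ∑ i ∈ Q, legendre L (X i ω)} ≤
      expMomentBound s ^ Q.card * ENNReal.ofReal (Real.exp (-(κ * (s * z)))) := by
  have := hind.isProbabilityMeasure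
  have hI : Measurable fun x => EReal.exp (legendre L x * (κ * s : ℝ)) :=
    ((lowerSemicontinuous_legendre L).measurable.mul_const _).ereal_exp
  have hmarkov := mul_meas_ge_le_lintegral (μ := μ)
    (Finset.measurable_fun_prod Q fun i _ => hI.comp (hX i))
    (ENNReal.ofReal (Real.exp (z * (κ * s))))
  have hprod := lintegral_prod_eq_prod_lintegral_of_indepFun Q
    (fun i ω => EReal.exp (legendre L (X i ω) * (κ * s : ℝ)))
    (hind.comp (fun _ x => EReal.exp (legendre L x * (κ * s : ℝ))) fun _ => hI)
    fun i => hI.comp (hX i)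
  have hbound : ∏ i ∈ Q, ∫⁻ ω, EReal.exp (legendre L (X i ω) * (κ * s : ℝ)) ∂μ ≤
      expMomentBound s ^ Q.card :=
    Finset.prod_le_pow_card _ _ _ fun i _ => lintegral_exp_legendre_le (hX i) hκ hd (hmgf i) hs
  have hsub : μ {ω | (z : EReal) ≤ ∑ i ∈ Q, legendre L (X i ω)} ≤
      μ {ω | ENNReal.ofReal (Real.exp (z * (κ * s))) ≤
        ∏ i ∈ Q, EReal.exp (legendre L (X i ω) * (κ * s : ℝ))} := by
    refine measure_mono fun ω (hω : (z : EReal) ≤ _) => ?_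
    rw [Set.mem_ofPred_eq, ← exp_sum_mul _ _ (by positivity), ← EReal.exp_coe, EReal.coe_mul]
    exact EReal.exp_monotone (mul_le_mul_of_nonneg_right hω (by exact_mod_cast (by positivity)))
  have h := (mul_le_mul_right hsub _).trans
    (hmarkov.trans (hprod.le.trans hbound))
  calc μ {ω | (z : EReal) ≤ ∑ i ∈ Q, legendre L (X i ω)}
      = ENNReal.ofReal (Real.exp (-(κ * (s * z)))) * (ENNReal.ofReal (Real.exp (z * (κ * s))) *
        μ {ω | (z : EReal) ≤ ∑ i ∈ Q, legendre L (X i ω)}) := by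
        rw [← mul_assoc, ← ENNReal.ofReal_mul (Real.exp_pos _).le, ← Real.exp_add,
          show -(κ * (s * z)) + z * (κ * s) = 0 by ring]
        simp
    _ ≤ _ := by rw [mul_comm (_ ^ _)]; gcongr

end

/-! ### The log-likelihood ratio and its rate functions -/

section

open ProbabilityTheory InformationTheory

theorem ofReal_integral_le_lintegral {Ω : Type*} [MeasurableSpace Ω] {μ : Measure Ω} {f : Ω → ℝ}
    (hf : Integrable f μ) : ENNReal.ofReal (∫ x, f x ∂μ) ≤ ∫⁻ x, ENNReal.ofReal (f x) ∂μ := by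
  rw [integral_eq_lintegral_pos_part_sub_lintegral_neg_part hf]
  exact (ENNReal.ofReal_le_ofReal (sub_le_self _ ENNReal.toReal_nonneg)).trans
    ENNReal.ofReal_toReal_le

theorem integrable_logLR_one {P : Fin 2 → Measure ℝ} (h : klDiv (P 1) (P 0) < ⊤) :
    Integrable (logLR P) (P 1) :=
  (klDiv_ne_top_iff.1 h.ne).2

variable (P : Fin 2 → Measure ℝ)

theorem measurable_logLR : Measurable (logLR P) := measurable_llr _ _

variable [∀ θ, IsProbabilityMeasure (P θ)]

theorem log_momentGen_zero (θ : Fin 2) : ENNReal.log (momentGen P θ 0) = 0 := by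
  simp [momentGen]

/-- Jensen's inequality: the mean of the log-likelihood ratio is the slope at `0` of a line below
the logarithm of the moment generating function. -/
theorem mean_mul_le_log_momentGen {θ : Fin 2} (hint : Integrable (logLR P) (P θ)) (w : ℝ) :
    (((∫ y, logLR P y ∂(P θ)) * w : ℝ) : EReal) ≤ ENNReal.log (momentGen P θ w) := by
  set d := ∫ y, logLR P y ∂(P θ) with hd
  suffices h : ENNReal.ofReal (Real.exp (d * w)) ≤ momentGen P θ w by
    have := ENNReal.log_monotone h
    rwa [ENNReal.log_ofReal_of_pos (Real.exp_pos _), Real.log_exp] at this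
  -- The exponential lies above its tangent at `d * w`.
  have hpt (y : ℝ) : Real.exp (d * w) * (1 + (w * logLR P y - d * w)) ≤
      Real.exp (w * logLR P y) := by
    calc _ ≤ Real.exp (d * w) * Real.exp (w * logLR P y - d * w) := by
          gcongr
          linarith [Real.add_one_le_exp (w * logLR P y - d * w)]
      _ = _ := by rw [← Real.exp_add]; ring_nf
  have hval : ∫ y, Real.exp (d * w) * (1 + (w * logLR P y - d * w)) ∂(P θ) =
      Real.exp (d * w) := by
    rw [integral_const_mul, integral_add (by fun_prop) (by fun_prop),
      integral_sub (by fun_prop) (by fun_prop), integral_const_mul, ← hd]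
    simp [mul_comm w d]
  calc ENNReal.ofReal (Real.exp (d * w))
      = ENNReal.ofReal (∫ y, Real.exp (d * w) * (1 + (w * logLR P y - d * w)) ∂(P θ)) := by
        rw [hval]
    _ ≤ ∫⁻ y, ENNReal.ofReal (Real.exp (d * w) * (1 + (w * logLR P y - d * w))) ∂(P θ) :=
        ofReal_integral_le_lintegral (by fun_prop)
    _ ≤ momentGen P θ w := lintegral_mono fun y => ENNReal.ofReal_le_ofReal (hpt y)

variable {P}

theorem momentGen_one_eq (hac01 : P 0 ≪ P 1) (hac10 : P 1 ≪ P 0) (w : ℝ) :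
    momentGen P 1 w = momentGen P 0 (w + 1) := by
  have hexp : ∀ᵐ y ∂(P 0), (P 1).rnDeriv (P 0) y = ENNReal.ofReal (Real.exp (logLR P y)) := by
    filter_upwards [hac01.ae_le (Measure.rnDeriv_pos hac10), Measure.rnDeriv_lt_top (P 1) (P 0)]
      with y hpos hlt
    rw [logLR, llr, Real.exp_log (ENNReal.toReal_pos hpos.ne' hlt.ne), ENNReal.ofReal_toReal hlt.ne]
  unfold momentGen
  rw [← lintegral_rnDeriv_mul hac10 (by have := measurable_logLR P; fun_prop)]
  refine lintegral_congr_ae ?_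
  filter_upwards [hexp] with y hy
  rw [hy, ← ENNReal.ofReal_mul (Real.exp_pos _).le, ← Real.exp_add]
  ring_nf

theorem rateFun_one_zero (hac01 : P 0 ≪ P 1) (hac10 : P 1 ≪ P 0) :
    rateFun P 1 0 = rateFun P 0 0 := by
  unfold rateFun
  rw [← (Equiv.addRight (1 : ℝ)).iSup_comp
    (g := fun w => ((0 * w : ℝ) : EReal) - ENNReal.log (momentGen P 0 w))]
  simp [momentGen_one_eq hac01 hac10]

theorem integrable_logLR_zero (h : klDiv (P 0) (P 1) < ⊤) : Integrable (logLR P) (P 0) := by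
  obtain ⟨hac, hint⟩ := klDiv_ne_top_iff.1 h.ne
  exact (hint.neg.congr (neg_llr hac))

theorem integral_logLR_one_pos (h0 : 0 < klDiv (P 1) (P 0)) (h : klDiv (P 1) (P 0) < ⊤) :
    0 < ∫ y, logLR P y ∂(P 1) := by
  have := toReal_klDiv_of_measure_eq (klDiv_ne_top_iff.1 h.ne).1 (by simp)
  exact this ▸ ENNReal.toReal_pos h0.ne' h.ne

theorem integral_logLR_zero_neg (h0 : 0 < klDiv (P 0) (P 1)) (h : klDiv (P 0) (P 1) < ⊤) :
    ∫ y, logLR P y ∂(P 0) < 0 := by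
  obtain ⟨hac, hint⟩ := klDiv_ne_top_iff.1 h.ne
  have h1 := toReal_klDiv_of_measure_eq hac (by simp)
  have h2 : ∫ y, logLR P y ∂(P 0) = - ∫ y, llr (P 0) (P 1) y ∂(P 0) := by
    rw [← integral_neg]
    exact integral_congr_ae (neg_llr hac).symm
  rw [h2, ← h1]
  exact neg_neg_of_pos (ENNReal.toReal_pos h0.ne' h.ne)

theorem rateFun_zero_zero_lt_top (hac01 : P 0 ≪ P 1) (hac10 : P 1 ≪ P 0)
    (h01 : klDiv (P 0) (P 1) < ⊤) (h10 : klDiv (P 1) (P 0) < ⊤)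
    (hpos1 : 0 < klDiv (P 1) (P 0)) (hpos0 : 0 < klDiv (P 0) (P 1)) : rateFun P 0 0 < ⊤ := by
  have hd := mean_mul_le_log_momentGen P (integrable_logLR_zero h01)
  have hd1 := integral_logLR_one_pos hpos1 h10
  have hd0 := integral_logLR_zero_neg hpos0 h01
  refine lt_of_le_of_lt (legendre_le (b := (-∫ y, logLR P y ∂(P 0) : ℝ)) hd fun w l hl => ?_)
    (EReal.coe_lt_top _)
  rw [EReal.coe_le_coe_iff]
  have h0 := hd w
  have h1 := mean_mul_le_log_momentGen P (integrable_logLR_one h10) (w - 1)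
  rw [momentGen_one_eq hac01 hac10, sub_add_cancel] at h1
  rw [hl, EReal.coe_le_coe_iff] at h0 h1
  rcases le_total w 1 with hw | hw <;> nlinarith

end

/-! ### Empirical means of independent measurements -/

section

open ProbabilityTheory

variable (P : Fin 2 → Measure ℝ) {m : ℕ}

/-- The empirical mean of the log-likelihood ratios of the true measurements of sensor `i`. -/
noncomputable def trueMean (k : ℕ) (i : Fin m) (y : ℕ × Fin m → ℝ) : ℝ :=
  (∑ t : Fin k, logLR P (y (t, i))) / k

theorem measurable_trueMean (k : ℕ) (i : Fin m) : Measurable (trueMean P k i) := by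
  have := measurable_logLR P
  unfold trueMean
  fun_prop

variable [∀ θ, IsProbabilityMeasure (P θ)]

instance (θ : Fin 2) : IsProbabilityMeasure (trueLaw P m θ) := by
  unfold trueLaw; infer_instance

/-- The sequences of measurements of different sensors are independent. -/
theorem iIndepFun_sensors (θ : Fin 2) :
    iIndepFun (fun (i : Fin m) (y : ℕ × Fin m → ℝ) (t : ℕ) => y (t, i)) (trueLaw P m θ) := by
  rw [iIndepFun_iff_map_fun_eq_infinitePi_map (by fun_prop)]
  have hrow (i : Fin m) : (trueLaw P m θ).map (fun (y : ℕ × Fin m → ℝ) (t : ℕ) => y (t, i)) =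
      Measure.infinitePi fun _ => P θ :=
    Measure.map_infinitePi_infinitePi_of_inj (P := fun _ : ℕ × Fin m => P θ)
      (f := fun t : ℕ => (t, i)) fun _ _ h => congrArg Prod.fst h
  have hswap : (trueLaw P m θ).map (fun (y : ℕ × Fin m → ℝ) (p : Fin m × ℕ) => y p.swap) =
      Measure.infinitePi fun _ => P θ :=
    Measure.map_infinitePi_infinitePi_of_inj (P := fun _ : ℕ × Fin m => P θ)
      (f := Prod.swap) Prod.swap_injective
  simp only [hrow]
  rw [← Measure.infinitePi_map_curry (fun (_ : Fin m) (_ : ℕ) => P θ), ← hswap,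
    Measure.map_map (MeasurableEquiv.measurable _) (by fun_prop)]
  rfl

theorem iIndepFun_trueMean (θ : Fin 2) (k : ℕ) :
    iIndepFun (trueMean P k : Fin m → _) (trueLaw P m θ) := by
  have := measurable_logLR P
  exact (iIndepFun_sensors P θ).comp
    (fun _ (u : ℕ → ℝ) => (∑ t : Fin k, logLR P (u t)) / k) fun _ => by fun_prop

theorem lintegral_exp_trueMean (θ : Fin 2) {k : ℕ} (hk : 0 < k) (i : Fin m) (w : ℝ) :
    ∫⁻ y, ENNReal.ofReal (Real.exp (w * (k * trueMean P k i y))) ∂(trueLaw P m θ) =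
      momentGen P θ w ^ k := by
  have hmeas := measurable_logLR P
  have hk' : (k : ℝ) ≠ 0 := by exact_mod_cast hk.ne'
  have hφ : Measurable fun x : ℝ => ENNReal.ofReal (Real.exp (w * logLR P x)) := by fun_prop
  have hind : iIndepFun (fun (t : Fin k) (y : ℕ × Fin m → ℝ) =>
      ENNReal.ofReal (Real.exp (w * logLR P (y (t, i))))) (trueLaw P m θ) :=
    (iIndepFun_infinitePi (P := fun _ : ℕ × Fin m => P θ)
      (X := fun _ x => ENNReal.ofReal (Real.exp (w * logLR P x))) fun _ => hφ).precomp
      (g := fun t : Fin k => ((t : ℕ), i)) fun _ _ h => Fin.ext (congrArg Prod.fst h)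
  have hprod (y : ℕ × Fin m → ℝ) : ENNReal.ofReal (Real.exp (w * (k * trueMean P k i y))) =
      ∏ t : Fin k, ENNReal.ofReal (Real.exp (w * logLR P (y (t, i)))) := by
    rw [← ENNReal.ofReal_prod_of_nonneg fun _ _ => (Real.exp_pos _).le, ← Real.exp_sum,
      ← Finset.mul_sum, trueMean, mul_div_cancel₀ _ hk']
  simp only [hprod]
  rw [lintegral_prod_eq_prod_lintegral_of_indepFun Finset.univ _ hind (fun t => by fun_prop)]
  have hone (t : Fin k) : ∫⁻ y, ENNReal.ofReal (Real.exp (w * logLR P (y ((t : ℕ), i))))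
      ∂(trueLaw P m θ) = momentGen P θ w :=
    (measurePreserving_eval_infinitePi (fun _ : ℕ × Fin m => P θ) ((t : ℕ), i)).lintegral_comp hφ
  simp [hone]

/-- The probability that the rate functions of the sensors in `Q` sum up to `z` decays at rate `z`,
up to a factor `s < 1` in the exponent. -/
theorem trueLaw_le_sum_rateFun_le {θ : Fin 2} (hint : Integrable (logLR P) (P θ)) {k : ℕ}
    (hk : 0 < k) {s : ℝ} (hs : 0 < s) (Q : Finset (Fin m)) (z : ℝ) :
    trueLaw P m θ {y | (z : EReal) ≤ ∑ i ∈ Q, rateFun P θ (trueMean P k i y)} ≤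
      expMomentBound s ^ m * ENNReal.ofReal (Real.exp (-(k * (s * z)))) := by
  have h := meas_le_sum_legendre_le (measurable_trueMean P k) (iIndepFun_trueMean P θ k)
    (κ := k) (by exact_mod_cast hk) (mean_mul_le_log_momentGen P hint) (fun i w l hl => ?_) hs Q z
  · refine h.trans (mul_le_mul_left (pow_le_pow_right₀ (one_le_expMomentBound s) ?_) _)
    simpa using Q.card_le_univ
  · rw [lintegral_exp_trueMean P θ hk, ← ENNReal.exp_log (momentGen P θ w), hl, EReal.exp_coe,
      ← ENNReal.ofReal_pow (Real.exp_pos _).le, ← Real.exp_nat_mul]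

end

/-! ### Sums of two opposed Legendre transforms -/

section

variable {L L' : ℝ → EReal} {d d' : ℝ} {ι : Type*} {O : Finset ι} {x : ι → ℝ} {z : ℝ}

/-- If a sum of transforms of `L` is below `z`, then by convexity the mean of the points is left of
the level `z / O.card` of the transform, and the opposed transform is monotone there. -/
theorem card_mul_legendre_level_le (h0 : L 0 = 0) (hd : ∀ w, ((d * w : ℝ) : EReal) ≤ L w)
    (hneg : d < 0) (h0' : L' 0 = 0) (hd' : ∀ w, ((d' * w : ℝ) : EReal) ≤ L' w) (hneg' : d' < 0)
    (hfin : legendre L 0 < ⊤) (hO : O.Nonempty) (hz0 : 0 < z)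
    (hz : (z : EReal) ≤ O.card * legendre L 0) (hx : ∑ i ∈ O, legendre L (x i) < z) :
    (O.card : EReal) * legendre L' (-sSup {y | legendre L y = ((z / O.card : ℝ) : EReal)}) ≤
      ∑ i ∈ O, legendre L' (-x i) := by
  have hq : (0 : ℝ) < O.card := by exact_mod_cast hO.card_pos
  have hq' : (0 : EReal) ≤ O.card := by exact_mod_cast hq.le
  have hzq : (O.card : EReal) * ((z / O.card : ℝ) : EReal) = z := by
    rw [show (O.card : EReal) = ((O.card : ℝ) : EReal) from rfl, ← EReal.coe_mul,
      mul_div_cancel₀ _ hq.ne']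
  have hmean : legendre L ((∑ i ∈ O, x i) / O.card) < ((z / O.card : ℝ) : EReal) := by
    by_contra! hcon
    have h := mul_le_mul_of_nonneg_left hcon hq'
    rw [hzq] at h
    exact absurd (h.trans (card_mul_legendre_mean_le hd hO x)) (not_le.2 hx)
  have hlevel : ((z / O.card : ℝ) : EReal) ≤ legendre L 0 := by
    obtain ⟨c, hc⟩ : ∃ c : ℝ, legendre L 0 = c :=
      ⟨_, (EReal.coe_toReal hfin.ne (ne_bot_of_le_ne_bot (by simp) (legendre_nonneg h0 0))).symm⟩
    rw [hc, show (O.card : EReal) = ((O.card : ℝ) : EReal) from rfl, ← EReal.coe_mul,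
      EReal.coe_le_coe_iff] at hz
    rw [hc, EReal.coe_le_coe_iff, div_le_iff₀' hq]
    exact hz
  obtain ⟨h1, h2⟩ := le_sSup_level h0 hd hneg (div_pos hz0 hq) hmean hlevel hfin
  refine le_trans ?_ (card_mul_legendre_mean_le hd' hO fun i => -x i)
  rw [Finset.sum_neg_distrib, neg_div]
  exact mul_le_mul_of_nonneg_left (legendre_mono h0' hd' (by linarith) (neg_le_neg h1)) hq'

end

/-! ### The error events of the detection rule -/

section

variable {P : Fin 2 → Measure ℝ} {m n k : ℕ} {Y : Fin k → Fin m → ℝ} {z ze : ℝ}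

theorem le_sum_of_le_trimmedSum {θ : Fin 2} (h : ¬ trimmedSum P n θ k Y < z)
    {O : Finset (Fin m)} (hO : O.card = m - n) :
    (z : EReal) ≤ ∑ i ∈ O, rateFun P θ (meanLLR P k Y i) :=
  (not_lt.1 h).trans (iInf₂_le O (Finset.mem_powersetCard.2 ⟨Finset.subset_univ O, hO⟩))

theorem exists_sum_lt_of_trimmedSum_lt {θ : Fin 2} (h : trimmedSum P n θ k Y < z) :
    ∃ O : Finset (Fin m), O.card = m - n ∧ ∑ i ∈ O, rateFun P θ (meanLLR P k Y i) < z := by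
  simp only [trimmedSum, iInf_lt_iff, Finset.mem_powersetCard] at h
  obtain ⟨O, ⟨-, hO⟩, hlt⟩ := h
  exact ⟨O, hO, hlt⟩

theorem AdmissiblePair.le_card_mul (hadm : AdmissiblePair P m n ze z) :
    (ze : EReal) ≤ (Finset.univ : Finset (Fin m)).card * rateFun P 0 0 := by
  rw [Finset.card_univ, Fintype.card_fin]
  rcases hadm.1.eq_or_lt with h | h
  · exact hadm.2.2.1 h.symm
  · exact (hadm.2.2.2 h).trans (min_le_left _ _)

/-- If the sensors outside `S` are sound, then the error of deciding `1` requires that their rate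
functions under `0` sum up to `z`. -/
theorem le_sum_compl_of_decision_ne_zero {S : Finset (Fin m)} (hS : S.card = n)
    (h : decision P n z k Y ≠ 0) :
    (z : EReal) ≤ ∑ i ∈ Sᶜ, rateFun P 0 (meanLLR P k Y i) := by
  refine le_sum_of_le_trimmedSum (n := n) (fun hlt => h ?_) (by simp [Finset.card_compl, hS])
  simp [decision, hlt]

/-- The reflected rate function under `1`, which like the one under `0` increases on the right of
`0`. -/
theorem legendre_momentGen_one_neg (x : ℝ) :
    legendre (fun w => ENNReal.log (momentGen P 1 (-w))) (-x) = rateFun P 1 x :=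
  legendre_comp_neg (fun w => ENNReal.log (momentGen P 1 w)) x

variable (P) in
/-- What the error analysis uses of the two laws: the logarithms of the moment generating functions
lie above lines of slopes of opposite signs, and the rate functions agree at `0`, where they are
finite. -/
structure Separated : Prop where
  line_zero : ∃ d < 0, ∀ w, ((d * w : ℝ) : EReal) ≤ ENNReal.log (momentGen P 0 w)
  line_one : ∃ d < 0, ∀ w, ((d * w : ℝ) : EReal) ≤ ENNReal.log (momentGen P 1 (-w))
  rateFun_one : rateFun P 1 0 = rateFun P 0 0
  rateFun_zero_lt_top : rateFun P 0 0 < ⊤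

theorem Separated.rateFun_one_reflected (hP : Separated P) :
    legendre (fun w => ENNReal.log (momentGen P 1 (-w))) 0 = rateFun P 0 0 := by
  rw [← hP.rateFun_one, ← legendre_momentGen_one_neg 0, neg_zero]

variable [∀ θ, IsProbabilityMeasure (P θ)]

theorem rateFun_nonneg (θ : Fin 2) (x : ℝ) : 0 ≤ rateFun P θ x :=
  legendre_nonneg (log_momentGen_zero P θ) x

theorem Separated.card_mul_rateFun_zero_le (hP : Separated P) {ι : Type*} {O : Finset ι}
    {x : ι → ℝ} (hx : 0 ≤ ∑ i ∈ O, x i) :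
    (O.card : EReal) * rateFun P 0 0 ≤ ∑ i ∈ O, rateFun P 0 (x i) := by
  obtain ⟨d, hneg, hd⟩ := hP.line_zero
  exact card_mul_legendre_zero_le (log_momentGen_zero P 0) hd hneg.le hx

theorem Separated.card_mul_rateFun_one_le (hP : Separated P) {ι : Type*} {O : Finset ι}
    {x : ι → ℝ} (hx : ∑ i ∈ O, x i ≤ 0) :
    (O.card : EReal) * rateFun P 0 0 ≤ ∑ i ∈ O, rateFun P 1 (x i) := by
  obtain ⟨d, hneg, hd⟩ := hP.line_one
  have h := card_mul_legendre_zero_le (x := fun i => -x i) (by simp [log_momentGen_zero]) hd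
    hneg.le (by simpa using hx)
  simpa only [legendre_momentGen_one_neg, hP.rateFun_one_reflected] using h

theorem Separated.card_mul_invRate0_le (hP : Separated P) {ι : Type*} {O : Finset ι}
    {x : ι → ℝ} (hO : O.Nonempty) (hz0 : 0 < z) (hz : (z : EReal) ≤ O.card * rateFun P 0 0)
    (hx : ∑ i ∈ O, rateFun P 0 (x i) < z) :
    (O.card : EReal) * rateFun P 1 (invRate0 P (z / O.card)) ≤ ∑ i ∈ O, rateFun P 1 (x i) := by
  obtain ⟨d, hneg, hd⟩ := hP.line_zero
  obtain ⟨d', hneg', hd'⟩ := hP.line_one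
  have h := card_mul_legendre_level_le (log_momentGen_zero P 0) hd hneg
    (by simp [log_momentGen_zero]) hd' hneg' hP.rateFun_zero_lt_top hO hz0 hz hx
  simp only [legendre_momentGen_one_neg] at h
  exact h

theorem Separated.card_mul_invRate1_le (hP : Separated P) {ι : Type*} {O : Finset ι}
    {x : ι → ℝ} (hO : O.Nonempty) (hz0 : 0 < z) (hz : (z : EReal) ≤ O.card * rateFun P 0 0)
    (hx : ∑ i ∈ O, rateFun P 1 (x i) < z) :
    (O.card : EReal) * rateFun P 0 (invRate1 P (z / O.card)) ≤ ∑ i ∈ O, rateFun P 0 (x i) := by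
  obtain ⟨d, hneg, hd⟩ := hP.line_zero
  obtain ⟨d', hneg', hd'⟩ := hP.line_one
  have h := card_mul_legendre_level_le (x := fun i => -x i)
    (by simp [log_momentGen_zero]) hd' hneg' (log_momentGen_zero P 0) hd hneg
    (by rw [hP.rateFun_one_reflected]; exact hP.rateFun_zero_lt_top) hO hz0
    (by rw [hP.rateFun_one_reflected]; exact hz)
    (by simpa only [legendre_momentGen_one_neg] using hx)
  have hset : {y | legendre (fun w => ENNReal.log (momentGen P 1 (-w))) y =
      ((z / O.card : ℝ) : EReal)} = -{y | rateFun P 1 y = ((z / O.card : ℝ) : EReal)} := by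
    ext y
    rw [Set.mem_neg, Set.mem_ofPred_eq, Set.mem_ofPred_eq, ← legendre_momentGen_one_neg, neg_neg]
  rw [hset, ← Real.sInf_neg, neg_neg] at h
  simp only [neg_neg] at h
  exact h

theorem Separated.le_sum_compl_of_decision_ne_one (hP : Separated P) (hmn : 2 * n < m)
    (hz : (z : EReal) ≤ (((m : ℝ) - 2 * n : ℝ) : EReal) * rateFun P 0 0)
    {S : Finset (Fin m)} (hS : S.card = n) (h : decision P n z k Y ≠ 1) :
    (z : EReal) ≤ ∑ i ∈ Sᶜ, rateFun P 1 (meanLLR P k Y i) := by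
  have hSc : Sᶜ.card = m - n := by simp [Finset.card_compl, hS]
  by_cases h0 : trimmedSum P n 0 k Y < z
  · obtain ⟨O, hO, hlt⟩ := exists_sum_lt_of_trimmedSum_lt h0
    -- At least `m - 2 * n` of the sensors in `O` are sound.
    have hcard : m - 2 * n ≤ (O ∩ Sᶜ).card := by
      have h1 := Finset.card_union_add_card_inter O Sᶜ
      have h2 := (O ∪ Sᶜ).card_le_univ
      rw [Fintype.card_fin] at h2
      omega
    have hcard' : (m : ℝ) - 2 * n ≤ ((O ∩ Sᶜ).card : ℝ) := by
      have : (m : ℝ) ≤ (O ∩ Sᶜ).card + 2 * n := by exact_mod_cast (by omega)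
      linarith
    have hz' : (z : EReal) ≤ (O ∩ Sᶜ).card * rateFun P 0 0 :=
      hz.trans (mul_le_mul_of_nonneg_right (EReal.coe_le_coe_iff.2 hcard') (rateFun_nonneg 0 0))
    have hlt' : ∑ i ∈ O ∩ Sᶜ, rateFun P 0 (meanLLR P k Y i) < z :=
      (Finset.sum_le_sum_of_subset_of_nonneg Finset.inter_subset_left
        fun i _ _ => rateFun_nonneg 0 _).trans_lt hlt
    have hneg : ∑ i ∈ O ∩ Sᶜ, meanLLR P k Y i ≤ 0 := by
      by_contra! hcon
      exact absurd (hz'.trans (hP.card_mul_rateFun_zero_le hcon.le)) (not_le.2 hlt')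
    exact (hz'.trans (hP.card_mul_rateFun_one_le hneg)).trans
      (Finset.sum_le_sum_of_subset_of_nonneg Finset.inter_subset_right
        fun i _ _ => rateFun_nonneg 1 _)
  · refine le_sum_of_le_trimmedSum (n := n) (fun h1 => h ?_) hSc
    simp [decision, h0, h1]

theorem trimmedSum_nonneg (θ : Fin 2) : 0 ≤ trimmedSum P n θ k Y :=
  le_iInf₂ fun _ _ => Finset.sum_nonneg fun _ _ => rateFun_nonneg θ _

theorem AdmissiblePair.level_le (hadm : AdmissiblePair P m n ze z) (hmn : 2 * n < m)
    {O : Finset (Fin m)} (hO : O.card = m - n) :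
    O.Nonempty ∧ (O.card : ℝ) = (m : ℝ) - n ∧ (z : EReal) ≤ O.card * rateFun P 0 0 := by
  have hcast : (O.card : ℝ) = (m : ℝ) - n := by rw [hO, Nat.cast_sub (by omega)]
  refine ⟨Finset.card_pos.1 (by omega), hcast, hadm.2.1.trans ?_⟩
  refine mul_le_mul_of_nonneg_right ?_ (rateFun_nonneg 0 0)
  rw [show (O.card : EReal) = ((O.card : ℝ) : EReal) from rfl, hcast, EReal.coe_le_coe_iff]
  have : (0 : ℝ) ≤ n := n.cast_nonneg
  linarith

theorem Separated.le_sum_univ_of_decision_ne_zero (hP : Separated P) (hmn : 2 * n < m)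
    (hadm : AdmissiblePair P m n ze z) (h : decision P n z k Y ≠ 0) :
    (ze : EReal) ≤ ∑ i, rateFun P 0 (meanLLR P k Y i) := by
  by_cases h1 : trimmedSum P n 1 k Y < z
  · obtain ⟨O, hO, hlt⟩ := exists_sum_lt_of_trimmedSum_lt h1
    have hz0 : 0 < z := by exact_mod_cast (trimmedSum_nonneg (P := P) 1).trans_lt h1
    obtain ⟨hne, hcast, hz⟩ := hadm.level_le hmn hO
    have hle := hP.card_mul_invRate1_le hne hz0 hz hlt
    rw [show (O.card : EReal) = ((O.card : ℝ) : EReal) from rfl, hcast] at hle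
    have hnn : (0 : EReal) ≤ ((m : ℝ) - n : ℝ) := by
      rw [← hcast]; exact_mod_cast O.card.cast_nonneg (α := ℝ)
    refine ((hadm.2.2.2 hz0).trans (min_le_right _ _)).trans ?_
    refine (mul_le_mul_of_nonneg_left (min_le_left _ _) hnn).trans (hle.trans ?_)
    exact Finset.sum_le_sum_of_subset_of_nonneg (Finset.subset_univ O)
      fun i _ _ => rateFun_nonneg 0 _
  · refine hadm.le_card_mul.trans (hP.card_mul_rateFun_zero_le ?_)
    by_contra! hcon
    simp [decision, h1, hcon] at h

theorem Separated.le_sum_univ_of_decision_ne_one (hP : Separated P) (hmn : 2 * n < m)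
    (hadm : AdmissiblePair P m n ze z) (h : decision P n z k Y ≠ 1) :
    (ze : EReal) ≤ ∑ i, rateFun P 1 (meanLLR P k Y i) := by
  by_cases h0 : trimmedSum P n 0 k Y < z
  · obtain ⟨O, hO, hlt⟩ := exists_sum_lt_of_trimmedSum_lt h0
    have hz0 : 0 < z := by exact_mod_cast (trimmedSum_nonneg (P := P) 0).trans_lt h0
    obtain ⟨hne, hcast, hz⟩ := hadm.level_le hmn hO
    have hle := hP.card_mul_invRate0_le hne hz0 hz hlt
    rw [show (O.card : EReal) = ((O.card : ℝ) : EReal) from rfl, hcast] at hle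
    have hnn : (0 : EReal) ≤ ((m : ℝ) - n : ℝ) := by
      rw [← hcast]; exact_mod_cast O.card.cast_nonneg (α := ℝ)
    refine ((hadm.2.2.2 hz0).trans (min_le_right _ _)).trans ?_
    refine (mul_le_mul_of_nonneg_left (min_le_right _ _) hnn).trans (hle.trans ?_)
    exact Finset.sum_le_sum_of_subset_of_nonneg (Finset.subset_univ O)
      fun i _ _ => rateFun_nonneg 1 _
  · refine hadm.le_card_mul.trans (hP.card_mul_rateFun_one_le ?_)
    by_contra! hcon
    by_cases h1 : trimmedSum P n 1 k Y < z
    · simp [decision, h0, h1] at h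
    · simp [decision, h0, h1, not_lt.2 hcon.le] at h

end

/-! ### From the error events to the rates -/

section

variable {m n : ℕ}

theorem Attack.measurable_biasAt (g : Attack m n) (θ : Fin 2) (S : Finset (Fin m)) (t : ℕ) :
    Measurable fun p : g.Seed × (ℕ × Fin m → ℝ) => g.biasAt θ S p.1 p.2 t := by
  induction t using Nat.strong_induction_on with
  | _ t ih =>
    have h : (fun p : g.Seed × (ℕ × Fin m → ℝ) => g.biasAt θ S p.1 p.2 t) = fun p =>
        g.bias θ S t p.1 (fun j i => p.2 (j, i)) (fun j => g.biasAt θ S p.1 p.2 j) := by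
      funext p; rw [Attack.biasAt]
    rw [h]
    refine (g.measurable_bias θ S t).comp (measurable_fst.prodMk (Measurable.prodMk ?_ ?_))
    · fun_prop
    · exact measurable_pi_lambda _ fun j => ih j j.isLt

theorem Attack.measurable_received (g : Attack m n) (θ : Fin 2) (S : Finset (Fin m)) (k : ℕ) :
    Measurable fun p : g.Seed × (ℕ × Fin m → ℝ) => g.received θ S p.1 p.2 k := by
  have := g.measurable_biasAt θ S
  unfold Attack.received
  fun_prop

theorem Attack.biasAt_eq_zero (g : Attack m n) (θ : Fin 2) {S : Finset (Fin m)} (hS : S.card = n)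
    (ω : g.Seed) (y : ℕ × Fin m → ℝ) (t : ℕ) {i : Fin m} (hi : i ∉ S) :
    g.biasAt θ S ω y t i = 0 := by
  rw [Attack.biasAt]
  exact g.sparse θ S hS _ _ _ _ i hi

theorem noAttack_biasAt (θ : Fin 2) (S : Finset (Fin m)) (ω : (noAttack m n).Seed)
    (y : ℕ × Fin m → ℝ) (t : ℕ) : (noAttack m n).biasAt θ S ω y t = 0 := by
  rw [Attack.biasAt]
  rfl

variable (P : Fin 2 → Measure ℝ)

theorem meanLLR_received {g : Attack m n} {θ : Fin 2} {S : Finset (Fin m)} {ω : g.Seed}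
    {y : ℕ × Fin m → ℝ} {i : Fin m} (h : ∀ t, g.biasAt θ S ω y t i = 0) (k : ℕ) :
    meanLLR P k (g.received θ S ω y k) i = trueMean P k i y := by
  simp [meanLLR, trueMean, Attack.received, h]

theorem coe_le_liminf_of_exp_bound {K : ENNReal} (hK : K ≠ ⊤) {a : ℕ → ENNReal} {c : ℝ}
    (h : ∀ k : ℕ, 0 < k → a k ≤ K * ENNReal.ofReal (Real.exp (-(k * c)))) :
    (c : EReal) ≤ liminf (fun k : ℕ => -(ENNReal.log (a k)) / (k : EReal)) atTop := by
  -- Enlarging the factor makes its logarithm real.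
  obtain ⟨r, hr, hKr⟩ : ∃ r : ℝ, 0 < r ∧ K ≤ ENNReal.ofReal r :=
    ⟨K.toReal + 1, by positivity, by
      rw [← ENNReal.ofReal_toReal hK, ENNReal.toReal_ofReal ENNReal.toReal_nonneg]
      exact ENNReal.ofReal_le_ofReal (by linarith)⟩
  have hlim : Tendsto (fun k : ℕ => ((c - Real.log r / k : ℝ) : EReal)) atTop
      (nhds (c : EReal)) := by
    refine EReal.tendsto_coe.2 ?_
    simpa using tendsto_const_nhds.sub (tendsto_const_div_atTop_nhds_zero_nat (Real.log r))
  rw [← hlim.liminf_eq]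
  refine liminf_le_liminf ?_
  filter_upwards [eventually_gt_atTop 0] with k hk
  have hk' : (0 : ℝ) < k := by exact_mod_cast hk
  have hlog : ENNReal.log (a k) ≤ ((Real.log r - k * c : ℝ) : EReal) := by
    refine (ENNReal.log_monotone ((h k hk).trans (mul_le_mul_left hKr _))).trans_eq ?_
    rw [← ENNReal.ofReal_mul hr.le, ENNReal.log_ofReal_of_pos (mul_pos hr (Real.exp_pos _)),
      Real.log_mul hr.ne' (Real.exp_pos _).ne', Real.log_exp, ← sub_eq_add_neg]
  calc ((c - Real.log r / k : ℝ) : EReal)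
      = -((Real.log r - k * c : ℝ) : EReal) / (k : EReal) := by
        rw [← EReal.coe_neg, show (k : EReal) = ((k : ℝ) : EReal) from rfl, ← EReal.coe_div]
        congr 1
        field_simp
        ring
    _ ≤ _ := EReal.div_le_div_right_of_nonneg (by exact_mod_cast hk'.le)
        (EReal.neg_le_neg_iff.2 hlog)

variable {P}

theorem measurableSet_le_sum_rateFun (θ : Fin 2) (k : ℕ) (Q : Finset (Fin m)) (z : ℝ) :
    MeasurableSet {y : ℕ × Fin m → ℝ |
      (z : EReal) ≤ ∑ i ∈ Q, rateFun P θ (trueMean P k i y)} :=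
  measurableSet_le measurable_const (Finset.measurable_fun_sum _ fun i _ =>
    (measurable_rateFun P θ).comp (measurable_trueMean P k i))

variable [∀ θ, IsProbabilityMeasure (P θ)]

/-- The probability of error is at most that of an event about the true measurements which contains
the error event whatever the private randomness. -/
theorem ofReal_errorProb_fStar_le {z : ℝ} {g : Attack m n} {θ : Fin 2} {S : Finset (Fin m)}
    {k : ℕ} {E : Set (ℕ × Fin m → ℝ)} (hE : MeasurableSet E)
    (h : ∀ ω y, decision P n z k (g.received θ S ω y k) ≠ (θ : ℕ) → y ∈ E) :
    ENNReal.ofReal (errorProb P (fStar P m n z) g θ S k) ≤ trueLaw P m θ E := by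
  have hmeas : Measurable fun p : g.Seed × (ℕ × Fin m → ℝ) =>
      decision P n z k (g.received θ S p.1 p.2 k) :=
    (measurable_decision P n z k).comp (g.measurable_received θ S k)
  have hmem (p : g.Seed × (ℕ × Fin m → ℝ)) :
      decision P n z k (g.received θ S p.1 p.2 k) ∈ Set.Icc (0 : ℝ) 1 :=
    (fStar P m n z).mem_unit k (g.received θ S p.1 p.2 k)
  have hint : Integrable (fun p : g.Seed × (ℕ × Fin m → ℝ) =>
      decision P n z k (g.received θ S p.1 p.2 k)) (g.law.prod (trueLaw P m θ)) :=
    .of_bound hmeas.aestronglyMeasurable 1 (.of_forall fun p => by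
      rw [Real.norm_eq_abs, abs_of_nonneg (hmem p).1]; exact (hmem p).2)
  have hprob : (g.law.prod (trueLaw P m θ)) (Prod.snd ⁻¹' E) = trueLaw P m θ E :=
    measurePreserving_snd.measure_preimage hE.nullMeasurableSet
  have key : ∀ f : g.Seed × (ℕ × Fin m → ℝ) → ℝ, Integrable f (g.law.prod (trueLaw P m θ)) →
      (∀ p, f p ≤ 1) → (∀ p, p.2 ∉ E → f p = 0) →
      ENNReal.ofReal (∫ p, f p ∂(g.law.prod (trueLaw P m θ))) ≤ trueLaw P m θ E := by
    intro f hf h1 h0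
    refine (ofReal_integral_le_lintegral hf).trans ?_
    rw [← hprob, ← lintegral_indicator_one (measurable_snd hE)]
    refine lintegral_mono fun p => ?_
    by_cases hp : p.2 ∈ E
    · rw [Set.indicator_of_mem (show p ∈ Prod.snd ⁻¹' E from hp), Pi.one_apply]
      exact ENNReal.ofReal_le_one.2 (h1 p)
    · simp [h0 p hp]
  have hnot (p : g.Seed × (ℕ × Fin m → ℝ)) (hp : p.2 ∉ E) :
      decision P n z k (g.received θ S p.1 p.2 k) = (θ : ℕ) := by
    by_contra hcon
    exact hp (h p.1 p.2 hcon)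
  obtain rfl | rfl : θ = 0 ∨ θ = 1 := by omega
  · exact key _ hint (fun p => (hmem p).2) fun p hp => (hnot p hp).trans (by simp)
  · have h1 : errorProb P (fStar P m n z) g 1 S k =
        ∫ p, (1 - decision P n z k (g.received 1 S p.1 p.2 k)) ∂(g.law.prod (trueLaw P m 1)) := by
      rw [integral_sub (integrable_const _) hint]
      simp [errorProb, fStar]
    refine (congrArg ENNReal.ofReal h1).trans_le (key _ ((integrable_const _).sub hint)
      (fun p => sub_le_self _ (hmem p).1) fun p hp => ?_)
    simp [hnot p hp]

/-- If each error event of the detection rule forces the rate functions of some sensors, at the true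
empirical means, to sum up to `c`, then the probability of error decays at rate `c`. -/
theorem le_rate_fStar (hint : ∀ θ, Integrable (logLR P) (P θ)) {z c : ℝ} {g : Attack m n}
    (h : ∀ (θ : Fin 2) (S : Finset (Fin m)), S.card = n → ∃ Q : Finset (Fin m), ∀ k ω y,
      decision P n z k (g.received θ S ω y k) ≠ (θ : ℕ) →
        (c : EReal) ≤ ∑ i ∈ Q, rateFun P θ (trueMean P k i y)) :
    (c : EReal) ≤ rate P (fStar P m n z) g := by
  have hs (s : ℝ) (hs0 : 0 < s) (hs1 : s < 1) :
      ((s * c : ℝ) : EReal) ≤ rate P (fStar P m n z) g := by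
    refine coe_le_liminf_of_exp_bound (ENNReal.pow_ne_top (expMomentBound_lt_top hs1).ne)
      (K := expMomentBound s ^ m) fun k hk => ?_
    refine iSup_le fun θ => iSup₂_le fun S hS => ?_
    obtain ⟨Q, hQ⟩ := h θ S (Finset.mem_powersetCard.1 hS).2
    exact (ofReal_errorProb_fStar_le (measurableSet_le_sum_rateFun θ k Q c) (hQ k)).trans
      (trueLaw_le_sum_rateFun_le P (hint θ) hk hs0 Q c)
  have hlim : Tendsto (fun s : ℝ => ((s * c : ℝ) : EReal)) (nhdsWithin 1 (Set.Iio 1))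
      (nhds (c : EReal)) := by
    have h1 : Continuous fun s : ℝ => ((s * c : ℝ) : EReal) :=
      continuous_coe_real_ereal.comp (by fun_prop)
    simpa using (h1.tendsto 1).mono_left nhdsWithin_le_nhds
  refine le_of_tendsto hlim ?_
  filter_upwards [Ioo_mem_nhdsLT (show (0 : ℝ) < 1 by norm_num)] with s hs'
  exact hs s hs'.1 hs'.2

end

end ByzantineDetection

theorem theorem4
    (P : Fin 2 → MeasureTheory.Measure ℝ) [∀ θ, MeasureTheory.IsProbabilityMeasure (P θ)]
    (hac01 : (P 0).AbsolutelyContinuous (P 1)) (hac10 : (P 1).AbsolutelyContinuous (P 0))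
    (hdom : ∀ θ, (0 : ℝ) ∈ interior {w : ℝ | ByzantineDetection.momentGen P θ w < ⊤})
    (hkl01 : 0 < InformationTheory.klDiv (P 0) (P 1))
    (hkl01' : InformationTheory.klDiv (P 0) (P 1) < ⊤)
    (hkl10 : 0 < InformationTheory.klDiv (P 1) (P 0))
    (hkl10' : InformationTheory.klDiv (P 1) (P 0) < ⊤)
    (m n : ℕ) (hmn : 2 * n < m)
    (ze zs : ℝ) (hadm : ByzantineDetection.AdmissiblePair P m n ze zs) :
    (ze : EReal) ≤ ByzantineDetection.efficiency P n (ByzantineDetection.fStar P m n zs) ∧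
      (zs : EReal) ≤ ByzantineDetection.security P n (ByzantineDetection.fStar P m n zs) := by
  open ByzantineDetection in
  have hint0 := integrable_logLR_zero hkl01'
  have hint1 := integrable_logLR_one hkl10'
  have hint : ∀ θ, Integrable (logLR P) (P θ) := Fin.forall_fin_two.2 ⟨hint0, hint1⟩
  have hP : Separated P :=
    { line_zero := ⟨_, integral_logLR_zero_neg hkl01 hkl01', mean_mul_le_log_momentGen P hint0⟩
      line_one := ⟨_, neg_neg_of_pos (integral_logLR_one_pos hkl10 hkl10'), fun w => by
        simpa using mean_mul_le_log_momentGen P hint1 (-w)⟩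
      rateFun_one := rateFun_one_zero hac01 hac10
      rateFun_zero_lt_top := rateFun_zero_zero_lt_top hac01 hac10 hkl01' hkl10' hkl10 hkl01 }
  constructor
  · refine le_rate_fStar hint fun θ S hS => ⟨Finset.univ, fun k ω y hne => ?_⟩
    simp only [← meanLLR_received P (fun t => congrFun (noAttack_biasAt θ S ω y t) _) k]
    fin_cases θ
    · exact hP.le_sum_univ_of_decision_ne_zero hmn hadm (by simpa using hne)
    · exact hP.le_sum_univ_of_decision_ne_one hmn hadm (by simpa using hne)
  · refine le_iInf fun g => le_rate_fStar hint fun θ S hS => ⟨Sᶜ, fun k ω y hne => ?_⟩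
    rw [← Finset.sum_congr rfl fun i hi => congrArg (rateFun P θ)
      (meanLLR_received P (fun t => g.biasAt_eq_zero θ hS ω y t (Finset.mem_compl.1 hi)) k)]
    fin_cases θ
    · exact le_sum_compl_of_decision_ne_zero hS (by simpa using hne)
    · exact hP.le_sum_compl_of_decision_ne_one hmn hadm.2.1 hS (by simpa using hne)
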